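/- Let $\mathcal X=[0,1]$ with its Borel $\sigma$-algebra and let $\mu=\mathrm{Uniform}([0,1])$. There exist a label space $\mathcal Y$ (a standard Borel space) and a nonempty class $\mathcal H\subseteq\mathcal Y^{\mathcal X}$ of measurable functions such that $\mathcal H$ is agnostic PAC learnable but $\mathcal H$ is not learnable in the smoothed online setting under $\mu$ and $\sigma=1$. Here: * $\mathcal H$ is *agnostic PAC learnable* if there are a function $m:(0,1)^2\to\mathbb N$ and a learning algorithm $\mathcal A$ mapping each finite sample $S\in(\mathcal X\times\mathcal Y)^n$ to a measurable predictor $\mathcal A_S:\mathcal X\to\mathcal Y$ such that, for all $\varepsilon,\delta\in(0,1)$, every probability distribution $\mathcal D$ on $\mathcal X\times\mathcal Y$ and every $n\ge m(\varepsilon,\delta)$, with probability at least $1-\delta$ over $S\sim\mathcal D^n$, $$\Pr_{(x,y)\sim\mathcal D}[\mathcal A_S(x)\ne y]\le\inf_{h\in\mathcal H}\Pr_{(x,y)\sim\mathcal D}[h(x)\ne y]+\varepsilon .$$ * For $\sigma>0$ let $B(\mu,\sigma)$ be the set of probability measures $\nu$ on $\mathcal X$ with $\nu(E)\le\mu(E)/\sigma$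 for all measurable $E$. A (randomized) online learner $\mathcal A$ outputs in round $t$ a random prediction $\mathcal A(x_t)\in\mathcal Y$ whose distribution is determined by the past examples $(x_1,y_1),\dots,(x_{t-1},y_{t-1})$ and $x_t$. Its worst-case expected regret over $T$ rounds is $$R^{\mu,\sigma}_{\mathcal A}(T,\mathcal H)=\sup_{\nu_1,\dots,\nu_T\in B(\mu,\sigma)}\ \mathbb E_{x_{1:T}\sim\nu_1\otimes\cdots\otimes\nu_T}\Big[\sup_{y_{1:T}\in\mathcal Y^T}\Big(\sum_{t=1}^T\mathbb E_{\mathcal A}\big[\mathbb 1\{\mathcal A(x_t)\ne y_t\}\big]-\inf_{h\in\mathcal H}\sum_{t=1}^T\mathbb 1\{h(x_t)\ne y_t\}\Big)\Big].$$ The class $\mathcal H$ is *learnable in the smoothed online setting under $\mu$ and $\sigma$* if $\inf_{\mathcal A}R^{\mu,\sigma}_{\mathcal A}(T,\mathcal H)=o(T)$ as $T\to\infty$. The learner need not depend measurably on the past examples, and the outer expectation is read as a lower integral if its integrand is not measurable. -/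

import Mathlib

open MeasureTheory Filter Topology
open scoped ENNReal

noncomputable section

namespace SmoothedLearning

variable {X Y : Type*}

/-! ### Agnostic PAC learning -/

section PAC

variable [MeasurableSpace X] [MeasurableSpace Y]

/-- The classification error `𝔼_{(x,y) ∼ D} 𝟙{h x ≠ y}`, that is, the `D`-probability of
the event `h x ≠ y`. -/
def classError (D : Measure (X × Y)) (h : X → Y) : ℝ≥0∞ :=
  D {p | h p.1 ≠ p.2}

/-- `H` is agnostic PAC learnable: there are a sample complexity `m` and a learning algorithm `A`,
mapping each finite sample to a (measurable, not necessarily in `H`) predictor, such that for all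
`ε, δ ∈ (0,1)`, all probability distributions `D` on `X × Y` and all `n ≥ m ε δ`, with probability
at least `1 - δ` over an i.i.d. sample `S ∼ D ^ n` the predictor `A S` has error at most
`inf_{h ∈ H} error(h) + ε`. "With probability at least `1 - δ`" is expressed by the failure event
having (outer) measure at most `δ`, so nothing is gained from non-measurable events. -/
def AgnosticPACLearnable (H : Set (X → Y)) : Prop :=
  ∃ (m : ℝ → ℝ → ℕ) (A : (n : ℕ) → (Fin n → X × Y) → X → Y),
    (∀ n S, Measurable (A n S)) ∧
    ∀ ε ∈ Set.Ioo (0 : ℝ) 1, ∀ δ ∈ Set.Ioo (0 : ℝ) 1,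
      ∀ D : ProbabilityMeasure (X × Y), ∀ n ≥ m ε δ,
        Measure.pi (fun _ : Fin n => (D : Measure (X × Y)))
          {S | ¬ classError (D : Measure (X × Y)) (A n S) ≤
              (⨅ h ∈ H, classError (D : Measure (X × Y)) h) + ENNReal.ofReal ε}
          ≤ ENNReal.ofReal δ

end PAC

/-! ### Smoothed online learning -/

/-- The set `B(μ, σ)` of `σ`-smooth distributions with respect to `μ`. -/
def smoothDistributions [MeasurableSpace X] (μ : Measure X) (σ : ℝ) :
    Set (ProbabilityMeasure X) :=
  {ν | ∀ E : Set X, MeasurableSet E → (ν : Measure X) E ≤ μ E / ENNReal.ofReal σ}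

/-- A randomized online learner: in the round with `t` past examples, given these examples and the
current instance, it returns the distribution of its prediction. (Against an oblivious adversary
the expected loss depends only on these distributions.) No measurability in the past is required,
so learners are as powerful as possible. -/
def OnlineLearner (X Y : Type*) [MeasurableSpace Y] : Type _ :=
  (t : ℕ) → (Fin t → X × Y) → X → ProbabilityMeasure Y

/-- Expected number of mistakes `∑_t 𝔼_A 𝟙{A(x_t) ≠ y_t}` of the learner on the stream
`(x_1, y_1), …, (x_T, y_T)`. -/
def OnlineLearner.expectedMistakes [MeasurableSpace Y] (A : OnlineLearner X Y) {T : ℕ}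
    (x : Fin T → X) (y : Fin T → Y) : ℝ :=
  ∑ t : Fin T,
    (A t (fun s => (x (Fin.castLE t.isLt.le s), y (Fin.castLE t.isLt.le s))) (x t)
      : Measure Y).real {z | z ≠ y t}

open Classical in
/-- Number of mistakes `∑_t 𝟙{h(x_t) ≠ y_t}` of the hypothesis `h`. -/
def mistakes (h : X → Y) {T : ℕ} (x : Fin T → X) (y : Fin T → Y) : ℝ :=
  ∑ t : Fin T, if h (x t) ≠ y t then 1 else 0

/-- Regret of the learner on the stream `(x_1, y_1), …, (x_T, y_T)` relative to `H`. -/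
def OnlineLearner.regretOn [MeasurableSpace Y] (A : OnlineLearner X Y) (H : Set (X → Y)) {T : ℕ}
    (x : Fin T → X) (y : Fin T → Y) : ℝ :=
  A.expectedMistakes x y - ⨅ h : H, mistakes (h : X → Y) x y

/-- Worst-case expected regret
`sup_{ν_1, …, ν_T ∈ B(μ,σ)} 𝔼_{x ∼ ν_1 ⊗ ⋯ ⊗ ν_T} sup_y regret(x, y)`.
For nonempty `H` the inner supremum lies in `[0, T]` (it is nonnegative because of the labelings
`y_t = h (x_t)` with `h ∈ H`), so it is computed in `ℝ≥0∞` without loss. -/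
def OnlineLearner.worstRegret [MeasurableSpace X] [MeasurableSpace Y] (A : OnlineLearner X Y)
    (μ : Measure X) (σ : ℝ) (H : Set (X → Y)) (T : ℕ) : ℝ≥0∞ :=
  ⨆ ν : Fin T → smoothDistributions μ σ,
    ∫⁻ x : Fin T → X, (⨆ y : Fin T → Y, ENNReal.ofReal (A.regretOn H x y))
      ∂(Measure.pi fun t => ((ν t : ProbabilityMeasure X) : Measure X))

/-- `H` is learnable in the smoothed online setting under the base measure `μ` and the parameter
`σ`: `inf_A R_A(T, H) = o(T)`, i.e. the minimax regret divided by `T` tends to `0`. -/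
def SmoothedOnlineLearnable [MeasurableSpace X] [MeasurableSpace Y]
    (μ : Measure X) (σ : ℝ) (H : Set (X → Y)) : Prop :=
  Tendsto (fun T : ℕ => (⨅ A : OnlineLearner X Y, A.worstRegret μ σ H T) / (T : ℝ≥0∞))
    atTop (𝓝 0)

end SmoothedLearning

end

/-! Labels are finite lists over a countable alphabet of pairs (basic open set, bit). Each list `L`
gives the hypothesis sending `x` to the longest suffix of `L` whose head cell contains `x` (`[]` if
there is none). Labels thus reveal much of `L` to a statistical learner, while an adversary can
build `L` backwards one entry at a time.

PAC side: a label `M` is a suffix of `L`, and `suffixLabel C M` agrees with `suffixLabel C L`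
wherever the latter gives a label no longer than `M` (`suffixLabel_eq_of_suffix`). Taking the last
length threshold that correct labels reach with probability at least `ε`, any one such label yields
a predictor losing less than `ε` (`exists_label_reconstruction`). The learner makes a candidate from
each early sample label and picks the best on held-out data.

Online side: i.i.d. uniform points are almost surely distinct. In each round the adversary prepends
a cell around the current point that misses all others, so earlier labels persist; the free bit
offers two labels, one of which the learner misses with probability at least 1/2. The final list
makes no mistakes, so the regret is at least `T / 2`. -/

namespace SmoothedLearning

open ProbabilityTheory

/-! ### Hold-out selection among countably many predictors -/

section HoldOut

variable {Z : Type*} [MeasurableSpace Z]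

/-- Chebyshev's inequality for the empirical frequency of `B` on the coordinates in `I`. -/
theorem measure_pi_frequency_deviation_le (D : Measure Z) [IsProbabilityMeasure D] {n : ℕ}
    {B : Set Z} (hB : MeasurableSet B) {I : Finset (Fin n)} (hI : I.Nonempty) {ε : ℝ}
    (hε : 0 < ε) :
    Measure.pi (fun _ : Fin n => D)
      {S | I.card * ε ≤ |∑ i ∈ I, B.indicator (1 : Z → ℝ) (S i) - I.card * D.real B|}
      ≤ ENNReal.ofReal (1 / (I.card * ε ^ 2)) := by
  set P := Measure.pi (fun _ : Fin n => D)
  set b : Z → ℝ := B.indicator 1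
  have hbm : Measurable b := measurable_one.indicator hB
  have hb01 : ∀ z, b z ∈ Set.Icc (0 : ℝ) 1 := fun z => by
    by_cases hz : z ∈ B <;> simp [b, hz]
  let V : Fin n → (Fin n → Z) → ℝ := fun i S => b (S i)
  have hVm : ∀ i, Measurable (V i) := fun i => hbm.comp (measurable_pi_apply i)
  have hV2 : ∀ i, MemLp (V i) 2 P := fun i =>
    MemLp.of_bound (hVm i).aestronglyMeasurable 1 (ae_of_all _ fun S => by
      have := hb01 (S i)
      rw [Real.norm_eq_abs, abs_le]
      exact ⟨by linarith [this.1], this.2⟩)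
  have hVint : ∀ i, ∫ S, V i S ∂P = D.real B := fun i => by
    have := integral_comp_eval (μ := fun _ : Fin n => D) (i := i) (f := b)
      hbm.aestronglyMeasurable
    rw [show ∫ S, V i S ∂P = ∫ z, b z ∂D from this]
    exact integral_indicator_one hB
  have hind : iIndepFun V P := iIndepFun_pi (X := fun _ : Fin n => b) fun _ => hbm.aemeasurable
  have hvar : Var[∑ i ∈ I, V i; P] ≤ I.card := by
    rw [IndepFun.variance_sum (fun i _ => hV2 i) fun i _ j _ hij => hind.indepFun hij]
    calc ∑ i ∈ I, Var[V i; P] ≤ ∑ _i ∈ I, (1 : ℝ) := Finset.sum_le_sum fun i _ => by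
          have := variance_le_sq_of_bounded (μ := P) (X := V i) (a := 0) (b := 1)
            (ae_of_all _ fun S => hb01 (S i)) (hVm i).aemeasurable
          norm_num at this
          linarith
      _ = I.card := by simp
  have hmean : ∫ S, (∑ i ∈ I, V i) S ∂P = I.card * D.real B := by
    simp only [Finset.sum_apply]
    rw [integral_finsetSum _ fun i _ => (hV2 i).integrable (by norm_num)]
    simp [hVint]
  have hc : (0 : ℝ) < I.card := by exact_mod_cast hI.card_pos
  have hcheb := meas_ge_le_variance_div_sq (μ := P) (X := ∑ i ∈ I, V i)
    (memLp_finsetSum' _ fun i _ => hV2 i) (c := I.card * ε) (by positivity)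
  rw [hmean] at hcheb
  simp only [Finset.sum_apply] at hcheb
  refine hcheb.trans (ENNReal.ofReal_le_ofReal ?_)
  calc Var[∑ i ∈ I, V i; P] / (I.card * ε) ^ 2 ≤ I.card / (I.card * ε) ^ 2 := by gcongr
    _ = 1 / (I.card * ε ^ 2) := by field_simp

/-- The deviation bound for a set `B` chosen, among countably many, through a coordinate `j` that
is not used in the empirical frequency. -/
theorem measure_pi_selected_deviation_le {Y : Type*} [MeasurableSpace Y] [Countable Y]
    [DiscreteMeasurableSpace Y] (D : Measure Z) [IsProbabilityMeasure D] {n : ℕ}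
    {c : Z → Y} (hc : Measurable c) {B : Y → Set Z} (hB : ∀ y, MeasurableSet (B y))
    {I : Finset (Fin n)} (hI : I.Nonempty) {j : Fin n} (hj : j ∉ I) {ε : ℝ} (hε : 0 < ε) :
    Measure.pi (fun _ : Fin n => D)
      {S | I.card * ε ≤ |∑ i ∈ I, (B (c (S j))).indicator (1 : Z → ℝ) (S i)
        - I.card * D.real (B (c (S j)))|}
      ≤ ENNReal.ofReal (1 / (I.card * ε ^ 2)) := by
  set P := Measure.pi (fun _ : Fin n => D)
  let dev : Y → Set (I → Z) := fun y =>
    {s | I.card * ε ≤ |∑ i, (B y).indicator (1 : Z → ℝ) (s i) - I.card * D.real (B y)|}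
  let sel : Y → Set (({j} : Finset (Fin n)) → Z) := fun y =>
    {s | c (s ⟨j, Finset.mem_singleton_self j⟩) = y}
  have hdev : ∀ y, MeasurableSet (dev y) := fun y =>
    measurableSet_le measurable_const
      ((Finset.measurable_sum _ fun i _ =>
        (measurable_one.indicator (hB y)).comp (measurable_pi_apply i)).sub_const _).abs
  have hsel : ∀ y, MeasurableSet (sel y) := fun y =>
    (hc.comp (measurable_pi_apply _)) (measurableSet_singleton y)
  have hind : iIndepFun (fun (i : Fin n) (S : Fin n → Z) => S i) P :=
    iIndepFun_pi (X := fun _ : Fin n => (id : Z → Z)) fun _ => aemeasurable_id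
  have hpair := hind.indepFun_finset {j} I (Finset.disjoint_singleton_left.2 hj)
    fun i => measurable_pi_apply i
  have hbound : ∀ y, P ((fun S (i : I) => S i) ⁻¹' dev y)
      ≤ ENNReal.ofReal (1 / (I.card * ε ^ 2)) := fun y => by
    refine le_trans (measure_mono fun S hS => ?_)
      (measure_pi_frequency_deviation_le D (hB y) hI hε)
    simp only [dev, Set.mem_preimage, Set.mem_ofPred_eq] at hS ⊢
    rwa [← Finset.sum_coe_sort]
  -- Splitting by the value of `c (S j)` costs no union bound: each piece is a product by
  -- independence, and the selection probabilities sum to 1.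
  have hcover : {S : Fin n → Z | I.card * ε ≤ |∑ i ∈ I,
        (B (c (S j))).indicator (1 : Z → ℝ) (S i) - I.card * D.real (B (c (S j)))|}
      ⊆ ⋃ y, ((fun S (i : ({j} : Finset (Fin n))) => S i) ⁻¹' sel y)
        ∩ ((fun S (i : I) => S i) ⁻¹' dev y) := fun S hS => by
    refine Set.mem_iUnion.2 ⟨c (S j), rfl, ?_⟩
    simp only [dev, Set.mem_preimage, Set.mem_ofPred_eq] at hS ⊢
    rwa [← Finset.sum_coe_sort] at hS
  have hcj : Measurable fun S : Fin n → Z => c (S j) := hc.comp (measurable_pi_apply j)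
  calc _ ≤ ∑' y, P (((fun S (i : ({j} : Finset (Fin n))) => S i) ⁻¹' sel y)
        ∩ ((fun S (i : I) => S i) ⁻¹' dev y)) := (measure_mono hcover).trans (measure_iUnion_le _)
    _ ≤ ∑' y, P ((fun S => c (S j)) ⁻¹' {y}) * ENNReal.ofReal (1 / (I.card * ε ^ 2)) := by
        refine ENNReal.tsum_le_tsum fun y => ?_
        rw [hpair.measure_inter_preimage_eq_mul _ _ (hsel y) (hdev y)]
        exact mul_le_mul' le_rfl (hbound y)
    _ = ENNReal.ofReal (1 / (I.card * ε ^ 2)) := by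
        rw [ENNReal.tsum_mul_right, ← measure_iUnion (fun y y' h => ?_)
          fun y => hcj (measurableSet_singleton y)]
        · rw [← Set.preimage_iUnion, Set.iUnion_of_singleton, Set.preimage_univ, measure_univ,
            one_mul]
        · exact Disjoint.preimage _ (Set.disjoint_singleton.2 h)

/-- The probability that the first `k` of `n` i.i.d. points avoid `G`. -/
theorem measure_pi_first_avoid (D : Measure Z) {n k : ℕ} [IsProbabilityMeasure D] (hk : k ≤ n)
    {G : Set Z} : Measure.pi (fun _ : Fin n => D) {S | ∀ i : Fin n, i.val < k → S i ∉ G}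
      = D Gᶜ ^ k := by
  have : {S : Fin n → Z | ∀ i : Fin n, i.val < k → S i ∉ G}
      = Set.pi Set.univ fun i => if i.val < k then Gᶜ else Set.univ := by
    ext S
    simp only [Set.mem_ofPred_eq, Set.mem_pi, Set.mem_univ, true_imp_iff]
    refine forall_congr' fun i => ?_
    by_cases hi : i.val < k <;> simp [hi]
  rw [this, Measure.pi_pi]
  simp only [apply_ite D, measure_univ, Finset.prod_ite, Finset.prod_const, one_pow, mul_one]
  congr 1
  rw [Fin.card_filter_val_lt, min_eq_right hk]

end HoldOut

section LabelReconstruction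

variable {X Y : Type*}

open Classical in
/-- Number of errors of `g` on the sample points with index at least `k`. -/
noncomputable def holdOutErrors {n : ℕ} (k : ℕ) (S : Fin n → X × Y) (g : X → Y) : ℝ :=
  ∑ i : Fin n with k ≤ i.val, {p : X × Y | g p.1 ≠ p.2}.indicator (1 : X × Y → ℝ) (S i)

/-- The selection rule of the learner; an arbitrary label is the default when there are no
candidates. -/
theorem exists_min_holdOutErrors [Nonempty Y] (f : Y → X → Y) (k n : ℕ) (S : Fin n → X × Y) :
    ∃ y : Y, ∀ j : Fin n, j.val < k →
      holdOutErrors k S (f y) ≤ holdOutErrors k S (f (S j).2) ∧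
      ∃ i : Fin n, i.val < k ∧ y = (S i).2 := by
  by_cases hne : (Finset.univ.filter fun j : Fin n => j.val < k).Nonempty
  · obtain ⟨i, hi, hmin⟩ := Finset.exists_min_image _
      (fun j : Fin n => holdOutErrors k S (f (S j).2)) hne
    exact ⟨(S i).2, fun j hj => ⟨hmin j (by simpa using hj), i, by simpa using hi, rfl⟩⟩
  · refine ⟨Classical.arbitrary Y, fun j hj => (hne ⟨j, by simpa using hj⟩).elim⟩

/-- A class is agnostic PAC learnable if, for countable `Y`, nearly optimal predictors can be
reconstructed from the label of a single sample point, for a set of sample points of non-negligible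
probability. -/
theorem agnosticPACLearnable_of_label_reconstruction [MeasurableSpace X] [MeasurableSpace Y]
    [Nonempty Y] [Countable Y] [DiscreteMeasurableSpace Y] {H : Set (X → Y)} (hH : H.Nonempty) (f : Y → X → Y)
    (hf : ∀ y, Measurable (f y))
    (hrec : ∀ D : ProbabilityMeasure (X × Y), ∀ h ∈ H, ∀ ε ∈ Set.Ioo (0 : ℝ) 1,
      ∃ G : Set (X × Y), MeasurableSet G ∧ ENNReal.ofReal ε ≤ (D : Measure (X × Y)) G ∧
        ∀ p ∈ G, classError (D : Measure (X × Y)) (f p.2)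
          ≤ classError (D : Measure (X × Y)) h + ENNReal.ofReal ε) :
    AgnosticPACLearnable H := by
  -- The first term bounds the chance that all `k` candidate points miss `G`, the second that some
  -- candidate's hold-out frequency deviates.
  have hk : ∀ ε ∈ Set.Ioo (0 : ℝ) 1, ∀ δ ∈ Set.Ioo (0 : ℝ) 1, ∃ K : ℕ, 2 ≤ K ∧ ∀ k ≥ K,
      (1 - ε / 4) ^ k + 1 / (((k : ℝ) - 1) * (ε / 4) ^ 2) ≤ δ := by
    intro ε hε δ hδ
    have h1 : Tendsto (fun k : ℕ => (1 - ε / 4) ^ k) atTop (𝓝 0) :=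
      tendsto_pow_atTop_nhds_zero_of_lt_one (by linarith [hε.2]) (by linarith [hε.1])
    have h2 : Tendsto (fun k : ℕ => 1 / (((k : ℝ) - 1) * (ε / 4) ^ 2)) atTop (𝓝 0) := by
      refine tendsto_const_nhds.div_atTop (Tendsto.atTop_mul_const (by have := hε.1; positivity) ?_)
      exact tendsto_atTop_add_const_right _ (-1) tendsto_natCast_atTop_atTop
    have h3 := h1.add h2
    rw [add_zero] at h3
    obtain ⟨K, hK⟩ := eventually_atTop.1 (h3.eventually_le_const hδ.1)
    exact ⟨max K 2, le_max_right _ _, fun k hk => hK k (le_of_max_le_left hk)⟩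
  choose! K hK2 hK using hk
  choose sel hsel using fun n S => exists_min_holdOutErrors f (Nat.sqrt n) n S
  -- With only `k = √n` candidates, at least `k * (k - 1)` points are held out, so Chebyshev
  -- survives a union bound over the candidates.
  refine ⟨fun ε δ => K ε δ ^ 2, fun n S => f (sel n S), fun n S => hf _, ?_⟩
  intro ε hε δ hδ D n hn
  set k := Nat.sqrt n with hkdef
  have hkK : K ε δ ≤ k := Nat.le_sqrt'.2 hn
  have hk2 : 2 ≤ k := (hK2 ε hε δ hδ).trans hkK
  have hkn : k * k ≤ n := Nat.sqrt_le n
  have hkn' : k ≤ n := Nat.sqrt_le_self n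
  -- One `η` pays for a near-optimal `h`, one for reconstruction, and two for the deviations of the
  -- chosen and the good candidate.
  set η := ε / 4 with hη
  have hη0 : 0 < η := by have := hε.1; positivity
  set μ : Measure (X × Y) := (D : Measure (X × Y)) with hμ
  set P := Measure.pi (fun _ : Fin n => μ) with hP
  let I : Finset (Fin n) := Finset.univ.filter fun i : Fin n => k ≤ i.val
  have hIcard : I.card = n - k := by
    have h1 := Fin.card_filter_val_lt (n := n) (m := k)
    have h2 := Finset.card_filter_add_card_filter_not (s := (Finset.univ : Finset (Fin n)))
      (fun i : Fin n => i.val < k)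
    simp only [not_lt, Finset.card_univ, Fintype.card_fin] at h2
    simp only [I]
    omega
  have hIlow : k * (k - 1) ≤ I.card := by
    rw [hIcard, Nat.mul_sub, mul_one]
    omega
  have hIne : I.Nonempty := by
    refine Finset.card_pos.1 (lt_of_lt_of_le ?_ hIlow)
    exact Nat.mul_pos (by omega) (by omega)
  have hIpos : (0 : ℝ) < I.card := by exact_mod_cast hIne.card_pos
  let B : Y → Set (X × Y) := fun y => {p | f y p.1 ≠ p.2}
  have hB : ∀ y, MeasurableSet (B y) := fun y =>
    (measurableSet_eq_fun ((hf y).comp measurable_fst) measurable_snd).compl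
  -- a nearly optimal hypothesis
  obtain ⟨h, hhH, hh⟩ : ∃ h ∈ H, classError μ h ≤ (⨅ h ∈ H, classError μ h) + ENNReal.ofReal η := by
    have hfin : (⨅ h ∈ H, classError μ h) ≠ ∞ := by
      obtain ⟨h, hh⟩ := hH
      exact ((iInf₂_le h hh).trans_lt (measure_lt_top μ _)).ne
    have hlt := ENNReal.lt_add_right hfin (ENNReal.ofReal_pos.2 hη0).ne'
    simp only [iInf_lt_iff] at hlt
    obtain ⟨h, hh, hlt⟩ := hlt
    exact ⟨h, hh, hlt.le⟩
  obtain ⟨G, hGm, hGμ, hG⟩ := hrec D h hhH η ⟨hη0, by linarith [hε.2]⟩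
  let avoid : Set (Fin n → X × Y) := {S | ∀ i : Fin n, i.val < k → S i ∉ G}
  let dev : Fin n → Set (Fin n → X × Y) := fun j =>
    {S | I.card * η ≤ |∑ i ∈ I, (B (S j).2).indicator (1 : X × Y → ℝ) (S i)
        - I.card * μ.real (B (S j).2)|}
  let J : Finset (Fin n) := Finset.univ.filter fun i : Fin n => i.val < k
  have hJcard : J.card = k := by
    simp only [J]
    rw [Fin.card_filter_val_lt, min_eq_right hkn']
  have hsub : {S | ¬ classError μ (f (sel n S)) ≤ (⨅ h ∈ H, classError μ h) + ENNReal.ofReal ε}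
      ⊆ avoid ∪ ⋃ j ∈ J, dev j := by
    intro S hS
    by_contra hcon
    simp only [Set.mem_union, not_or, Set.mem_iUnion, not_exists] at hcon
    obtain ⟨havoid, hdev⟩ := hcon
    simp only [avoid, Set.mem_ofPred_eq, not_forall, not_not] at havoid
    obtain ⟨j, hjk, hjG⟩ := havoid
    obtain ⟨hmin, i, hik, hi⟩ := hsel n S j hjk
    have hdi := hdev i (by simpa [J] using hik)
    have hdj := hdev j (by simpa [J] using hjk)
    simp only [dev, Set.mem_ofPred_eq, not_le, abs_lt] at hdi hdj
    rw [hi] at hmin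
    have hmin' : ∑ i' ∈ I, (B (S i).2).indicator (1 : X × Y → ℝ) (S i')
        ≤ ∑ i' ∈ I, (B (S j).2).indicator (1 : X × Y → ℝ) (S i') := hmin
    have hreal : μ.real (B (S i).2) ≤ μ.real (B (S j).2) + 2 * η := by
      have : I.card * μ.real (B (S i).2) ≤ I.card * (μ.real (B (S j).2) + 2 * η) := by
        linarith [hdi.1, hdj.2]
      exact le_of_mul_le_mul_left this hIpos
    have henn : classError μ (f (S i).2) ≤ classError μ (f (S j).2) + ENNReal.ofReal (2 * η) := by
      have := ENNReal.ofReal_le_ofReal hreal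
      rw [ENNReal.ofReal_add measureReal_nonneg (by positivity), ofReal_measureReal,
        ofReal_measureReal] at this
      exact this
    apply hS
    calc classError μ (f (sel n S)) = classError μ (f (S i).2) := by rw [hi]
      _ ≤ ((⨅ h ∈ H, classError μ h) + ENNReal.ofReal η) + ENNReal.ofReal η
          + ENNReal.ofReal (2 * η) :=
        henn.trans (add_le_add_left ((hG _ hjG).trans (add_le_add_left hh _)) _)
      _ = (⨅ h ∈ H, classError μ h) + ENNReal.ofReal ε := by
        rw [add_assoc, add_assoc, ← ENNReal.ofReal_add hη0.le (by positivity),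
          ← ENNReal.ofReal_add hη0.le (by positivity)]
        congr 2
        rw [hη]; ring
  have havoid : P avoid ≤ ENNReal.ofReal ((1 - η) ^ k) := by
    rw [measure_pi_first_avoid μ hkn', prob_compl_eq_one_sub hGm,
      ENNReal.ofReal_pow (by linarith [hε.2])]
    gcongr
    rw [ENNReal.ofReal_sub _ hη0.le, ENNReal.ofReal_one]
    exact tsub_le_tsub_left hGμ _
  have hdev : P (⋃ j ∈ J, dev j) ≤ ENNReal.ofReal (1 / (((k : ℝ) - 1) * η ^ 2)) := by
    calc P (⋃ j ∈ J, dev j) ≤ ∑ j ∈ J, P (dev j) := measure_biUnion_finset_le _ _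
      _ ≤ ∑ _j ∈ J, ENNReal.ofReal (1 / (I.card * η ^ 2)) := Finset.sum_le_sum fun j hj =>
          measure_pi_selected_deviation_le μ measurable_snd hB hIne
            (by simp only [I, J, Finset.mem_filter, Finset.mem_univ, true_and] at hj ⊢; omega) hη0
      _ = ENNReal.ofReal (k * (1 / (I.card * η ^ 2))) := by
          rw [Finset.sum_const, hJcard, nsmul_eq_mul, ENNReal.ofReal_mul (by positivity),
            ENNReal.ofReal_natCast]
      _ ≤ ENNReal.ofReal (1 / (((k : ℝ) - 1) * η ^ 2)) := by
          refine ENNReal.ofReal_le_ofReal ?_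
          have hkr : (2 : ℝ) ≤ k := by exact_mod_cast hk2
          have hlow : (k : ℝ) * (k - 1) ≤ I.card := by
            have : ((k * (k - 1) : ℕ) : ℝ) ≤ I.card := by exact_mod_cast hIlow
            rwa [Nat.cast_mul, Nat.cast_sub (by omega), Nat.cast_one] at this
          rw [mul_one_div, div_le_div_iff₀ (by positivity)
            (mul_pos (by linarith) (by positivity))]
          have := mul_le_mul_of_nonneg_right hlow (sq_nonneg η)
          linarith
  calc P _ ≤ P avoid + P (⋃ j ∈ J, dev j) := (measure_mono hsub).trans (measure_union_le _ _)
    _ ≤ ENNReal.ofReal ((1 - η) ^ k) + ENNReal.ofReal (1 / (((k : ℝ) - 1) * η ^ 2)) :=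
        add_le_add havoid hdev
    _ = ENNReal.ofReal ((1 - η) ^ k + 1 / (((k : ℝ) - 1) * η ^ 2)) := by
        have hkr : (2 : ℝ) ≤ k := by exact_mod_cast hk2
        rw [ENNReal.ofReal_add (pow_nonneg (by linarith [hε.2]) _)
          (one_div_nonneg.2 (mul_nonneg (by linarith) (by positivity)))]
    _ ≤ ENNReal.ofReal δ := ENNReal.ofReal_le_ofReal (hK ε hε δ hδ k hkK)

end LabelReconstruction

/-! ### The class of longest-suffix labelings -/

section SuffixLabel

variable {X E : Type*}

open Classical in
/-- The longest suffix of `L` whose first entry `e` has a cell `C e` containing `x`. -/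
noncomputable def suffixLabel (C : E → Set X) : List E → X → List E
  | [], _ => []
  | e :: L, x => if x ∈ C e then e :: L else suffixLabel C L x

theorem suffixLabel_suffix (C : E → Set X) (L : List E) (x : X) : suffixLabel C L x <:+ L := by
  induction L with
  | nil => exact List.suffix_refl _
  | cons e L ih =>
    rw [suffixLabel]
    split_ifs
    · exact List.suffix_refl _
    · exact ih.trans (List.suffix_cons e L)

/-- Entries of `L` in front of `M` cannot be the ones that catch `x`, since the resulting label
would be longer than `M`; deleting them changes nothing at `x`. -/
theorem suffixLabel_eq_of_suffix (C : E → Set X) {L M : List E} {x : X} (hM : M <:+ L)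
    (hx : suffixLabel C L x <:+ M) : suffixLabel C M x = suffixLabel C L x := by
  induction L with
  | nil => rw [List.suffix_nil.1 hM]
  | cons e L ih =>
    rcases List.suffix_cons_iff.1 hM with rfl | hM'
    · rfl
    · rw [suffixLabel] at hx ⊢
      split_ifs at hx ⊢ with hxe
      · have := (hx.trans hM').length_le
        simp at this
      · exact ih hM' hx

theorem measurable_suffixLabel [MeasurableSpace X] [MeasurableSpace (List E)] {C : E → Set X}
    (hC : ∀ e, MeasurableSet (C e)) (L : List E) : Measurable (suffixLabel C L) := by
  induction L with
  | nil => exact measurable_const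
  | cons e L ih => exact Measurable.ite (hC e) measurable_const ih

/-- A label of `suffixLabel C L` determines this labeling up to the strictly longer labels. -/
theorem exists_label_reconstruction [MeasurableSpace X] [Countable E] [MeasurableSpace (List E)]
    [DiscreteMeasurableSpace (List E)] {C : E → Set X} (hC : ∀ e, MeasurableSet (C e))
    (D : ProbabilityMeasure (X × List E)) (L : List E) {ε : ℝ} (hε : ε ∈ Set.Ioo (0 : ℝ) 1) :
    ∃ G : Set (X × List E), MeasurableSet G ∧ ENNReal.ofReal ε ≤ (D : Measure (X × List E)) G ∧
      ∀ p ∈ G, classError (D : Measure (X × List E)) (suffixLabel C p.2)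
        ≤ classError (D : Measure (X × List E)) (suffixLabel C L) + ENNReal.ofReal ε := by
  set μ : Measure (X × List E) := (D : Measure (X × List E))
  let G : ℕ → Set (X × List E) := fun l => {p | suffixLabel C L p.1 = p.2 ∧ l ≤ p.2.length}
  have hGm : ∀ l, MeasurableSet (G l) := fun l =>
    (measurableSet_eq_fun ((measurable_suffixLabel hC L).comp measurable_fst)
      measurable_snd).inter (measurable_snd (MeasurableSet.of_discrete (s := {M : List E | l ≤ M.length})))
  by_cases h0 : ENNReal.ofReal ε ≤ μ (G 0)
  -- A last heavy threshold exists because `G l` is empty once `l` exceeds the length of `L`.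
  · obtain ⟨l, hl, hl'⟩ : ∃ l, ENNReal.ofReal ε ≤ μ (G l) ∧ ¬ ENNReal.ofReal ε ≤ μ (G (l + 1)) := by
      by_contra! hcon
      have hall : ∀ l, ENNReal.ofReal ε ≤ μ (G l) := fun l => by
        induction l with
        | zero => exact h0
        | succ l ih => exact hcon l ih
      have hempty : G (L.length + 1) = ∅ := by
        ext p
        simp only [G, Set.mem_ofPred_eq, Set.mem_empty_iff_false, iff_false, not_and, not_le]
        intro hp
        rw [← hp]
        exact Nat.lt_succ_of_le (suffixLabel_suffix C L p.1).length_le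
      have := hall (L.length + 1)
      rw [hempty, measure_empty] at this
      exact absurd this (not_le.2 (ENNReal.ofReal_pos.2 hε.1))
    refine ⟨G l, hGm l, hl, fun p hp => ?_⟩
    have hsub : {q : X × List E | suffixLabel C p.2 q.1 ≠ q.2}
        ⊆ {q | suffixLabel C L q.1 ≠ q.2} ∪ G (l + 1) := by
      intro q hq
      by_cases hq1 : suffixLabel C L q.1 = q.2
      · refine Or.inr ⟨hq1, ?_⟩
        by_contra hlen
        have hpL : p.2 <:+ L := hp.1 ▸ suffixLabel_suffix C L p.1
        have hqL : q.2 <:+ L := hq1 ▸ suffixLabel_suffix C L q.1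
        have hlp := hp.2
        have hqp : q.2 <:+ p.2 := List.suffix_of_suffix_length_le hqL hpL (by omega)
        exact hq ((suffixLabel_eq_of_suffix C hpL (hq1 ▸ hqp)).trans hq1)
      · exact Or.inl hq1
    exact (measure_mono hsub).trans ((measure_union_le _ _).trans
      (add_le_add_right (not_le.1 hl').le _))
  -- Here `suffixLabel C L` is correct with probability below `ε`, so every predictor is good
  -- enough.
  · refine ⟨Set.univ, MeasurableSet.univ, ?_, fun p _ => ?_⟩
    · rw [measure_univ, ENNReal.ofReal_le_one]
      exact hε.2.le
    · have hcover : (Set.univ : Set (X × List E))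
          ⊆ {q | suffixLabel C L q.1 ≠ q.2} ∪ G 0 := by
        intro q _
        by_cases hq : suffixLabel C L q.1 = q.2
        · exact Or.inr ⟨hq, Nat.zero_le _⟩
        · exact Or.inl hq
      exact (measure_mono (Set.subset_univ _)).trans ((measure_mono hcover).trans
        ((measure_union_le _ _).trans (add_le_add_right (not_le.1 h0).le _)))

end SuffixLabel

/-! ### The lower bound for online learners -/

section Online

variable {X E : Type*}

theorem exists_bool_half_le_measureReal_ne {Y : Type*} [MeasurableSpace Y]
    [MeasurableSingletonClass Y] (ρ : Measure Y) [IsProbabilityMeasure ρ] {y : Bool → Y}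
    (hy : y true ≠ y false) : ∃ b, 1 / 2 ≤ ρ.real {z | z ≠ y b} := by
  by_contra! hcon
  have hcover : ({z | z ≠ y true} : Set Y) ∪ {z | z ≠ y false} = Set.univ := by
    ext z
    simp only [Set.mem_union, Set.mem_ofPred_eq, Set.mem_univ, iff_true]
    by_contra! h
    exact hy (h.1.symm.trans h.2)
  have := measureReal_union_le (μ := ρ) {z | z ≠ y true} {z | z ≠ y false}
  rw [hcover, probReal_univ] at this
  linarith [hcon true, hcon false]

/-- If the cells of `e t b` separate `x t` from the other instances, then some labeling that is
realized by the class makes the learner err with probability at least `1 / 2` in every round. -/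
theorem exists_hard_labeling [MeasurableSpace (List E)] [MeasurableSingletonClass (List E)]
    {C : E → Set X} {T : ℕ} (x : Fin T → X) (e : Fin T → Bool → E)
    (he : ∀ t, e t true ≠ e t false) (hmem : ∀ t b, x t ∈ C (e t b))
    (hsep : ∀ s t b, s < t → x s ∉ C (e t b)) (A : OnlineLearner X (List E)) :
    ∃ (L : List E) (y : Fin T → List E), (∀ t, suffixLabel C L (x t) = y t) ∧
      (T : ℝ) / 2 ≤ A.expectedMistakes x y := by
  -- Indexing `y` by `ℕ` lets round `n` be set by `Function.update` without disturbing the past that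
  -- the learner sees.
  have key : ∀ n ≤ T, ∃ (L : List E) (y : ℕ → List E),
      (∀ t : Fin T, t.val < n → suffixLabel C L (x t) = y t) ∧
      ∀ t : Fin T, t.val < n → 1 / 2 ≤
        (A t (fun s => (x (Fin.castLE t.isLt.le s), y s)) (x t) : Measure (List E)).real
          {z | z ≠ y t} := by
    intro n
    induction n with
    | zero => exact fun _ => ⟨[], fun _ => [], by simp, by simp⟩
    | succ n ih =>
      intro hn
      obtain ⟨L, y, hL, hy⟩ := ih (by omega)
      obtain ⟨b, hb⟩ := exists_bool_half_le_measureReal_ne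
        (A n (fun s => (x (Fin.castLE (Nat.le_of_succ_le hn) s), y s)) (x ⟨n, hn⟩) :
          Measure (List E))
        (y := fun b => e ⟨n, hn⟩ b :: L) (by simpa using he ⟨n, hn⟩)
      have hupd : ∀ s, s < n →
          Function.update y n (e ⟨n, hn⟩ b :: L) s = y s := fun s hs =>
        Function.update_of_ne hs.ne _ _
      refine ⟨e ⟨n, hn⟩ b :: L, Function.update y n (e ⟨n, hn⟩ b :: L), ?_, ?_⟩
      · intro t ht
        rcases Nat.lt_succ_iff_lt_or_eq.1 ht with ht | ht
        · rw [hupd _ ht, suffixLabel, if_neg (hsep t ⟨n, hn⟩ b ht), hL t ht]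
        · obtain rfl : t = ⟨n, hn⟩ := Fin.ext ht
          rw [Function.update_self, suffixLabel, if_pos (hmem _ b)]
      · intro t ht
        have hpast : ∀ s : Fin t.val, Function.update y n (e ⟨n, hn⟩ b :: L) s = y s :=
          fun s => hupd s (by omega)
        simp only [hpast]
        rcases Nat.lt_succ_iff_lt_or_eq.1 ht with ht | ht
        · rw [hupd _ ht]
          exact hy t ht
        · obtain rfl : t = ⟨n, hn⟩ := Fin.ext ht
          rw [Function.update_self]
          exact hb
  obtain ⟨L, y, hL, hy⟩ := key T le_rfl
  refine ⟨L, fun t => y t, fun t => hL t t.isLt, ?_⟩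
  calc (T : ℝ) / 2 = ∑ _t : Fin T, (1 / 2 : ℝ) := by simp [div_eq_mul_inv]
    _ ≤ _ := Finset.sum_le_sum fun t _ => hy t t.isLt

theorem mistakes_nonneg {Y : Type*} (h : X → Y) {T : ℕ} (x : Fin T → X) (y : Fin T → Y) :
    0 ≤ mistakes h x y :=
  Finset.sum_nonneg fun _ _ => by split_ifs <;> norm_num

/-- Independent draws from an atomless distribution are almost surely distinct. -/
theorem ae_injective_pi [MeasurableSpace X] [MeasurableSingletonClass X] [MeasurableEq X]
    (μ : Measure X) [IsProbabilityMeasure μ] [NullSingletonClass μ] (T : ℕ) :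
    ∀ᵐ x ∂(Measure.pi fun _ : Fin T => μ), Function.Injective x := by
  have hpair : ∀ i j : Fin T, i ≠ j → ∀ᵐ x ∂(Measure.pi fun _ : Fin T => μ), x i ≠ x j := by
    intro i j hij
    have hind : iIndepFun (fun (i : Fin T) (x : Fin T → X) => x i)
        (Measure.pi fun _ : Fin T => μ) :=
      iIndepFun_pi (X := fun _ : Fin T => (id : X → X)) fun _ => aemeasurable_id
    have hmap := (indepFun_iff_map_prod_eq_prod_map_map (measurable_pi_apply i).aemeasurable
      (measurable_pi_apply j).aemeasurable).1 (hind.indepFun hij)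
    rw [(measurePreserving_eval (fun _ : Fin T => μ) i).map_eq,
      (measurePreserving_eval (fun _ : Fin T => μ) j).map_eq] at hmap
    have hdiag : (μ.prod μ) (Set.diagonal X) = 0 := by
      rw [Measure.measure_prod_null measurableSet_diagonal]
      refine ae_of_all _ fun a => ?_
      have : Prod.mk a ⁻¹' Set.diagonal X = {a} := by
        ext b; simp [eq_comm]
      simp only [this, measure_singleton, Pi.zero_apply]
    rw [← hmap, Measure.map_apply ((measurable_pi_apply i).prodMk (measurable_pi_apply j))
      measurableSet_diagonal] at hdiag
    exact measure_eq_zero_iff_ae_notMem.1 hdiag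
  have hall : ∀ᵐ x ∂(Measure.pi fun _ : Fin T => μ), ∀ i j : Fin T, i ≠ j → x i ≠ x j :=
    ae_all_iff.2 fun i => ae_all_iff.2 fun j => by
      by_cases hij : i = j
      · simp [hij]
      · simpa [hij] using hpair i j hij
  filter_upwards [hall] with x hx i j hij
  by_contra hne
  exact hx i j hne hij

/-- For an atomless base measure, the class of longest-suffix labelings over a basis of the
topology is not learnable in the smoothed online setting. -/
theorem not_smoothedOnlineLearnable_suffixLabel [TopologicalSpace X] [T1Space X]
    [MeasurableSpace X] [BorelSpace X] [MeasurableEq X] {𝓑 : Set (Set X)}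
    (h𝓑 : TopologicalSpace.IsTopologicalBasis 𝓑) [MeasurableSpace (List (𝓑 × Bool))]
    [MeasurableSingletonClass (List (𝓑 × Bool))]
    (μ : Measure X) [IsProbabilityMeasure μ] [NullSingletonClass μ] :
    ¬ SmoothedOnlineLearnable μ 1
      (Set.range (suffixLabel fun e : 𝓑 × Bool => (e.1 : Set X))) := by
  set C : 𝓑 × Bool → Set X := fun e => (e.1 : Set X)
  have hregret : ∀ (T : ℕ) (A : OnlineLearner X (List (𝓑 × Bool))) (x : Fin T → X),
      Function.Injective x →
      ENNReal.ofReal (T / 2) ≤ ⨆ y, ENNReal.ofReal (A.regretOn (Set.range (suffixLabel C)) x y) := by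
    intro T A x hx
    -- The other instances form a finite, hence closed, set not containing `x t`.
    have hcell : ∀ t : Fin T, ∃ U ∈ 𝓑, x t ∈ U ∧ U ⊆ (x '' {s | s ≠ t})ᶜ := fun t =>
      h𝓑.exists_subset_of_mem_open
        (by rintro ⟨s, hs, hst⟩; exact hs (hx hst))
        ((Set.toFinite _).isClosed.isOpen_compl)
    choose U hU𝓑 hxU hUs using hcell
    obtain ⟨L, y, hL, hy⟩ := exists_hard_labeling (C := C) x (fun t b => (⟨U t, hU𝓑 t⟩, b))
      (by simp) (fun t b => hxU t)
      (fun s t b hst hs => hUs t hs ⟨s, hst.ne, rfl⟩) A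
    refine le_trans (ENNReal.ofReal_le_ofReal ?_)
      (le_iSup (fun y => ENNReal.ofReal (A.regretOn (Set.range (suffixLabel C)) x y)) y)
    have hinf : ⨅ h : Set.range (suffixLabel C), mistakes (h : X → List (𝓑 × Bool)) x y ≤ 0 := by
      have h1 := ciInf_le (f := fun h : Set.range (suffixLabel C) =>
          mistakes (h : X → List (𝓑 × Bool)) x y)
        ⟨0, by rintro _ ⟨h, rfl⟩; exact mistakes_nonneg _ _ _⟩ ⟨suffixLabel C L, L, rfl⟩
      refine h1.trans_eq ?_
      simp [mistakes, hL]
    rw [OnlineLearner.regretOn]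
    linarith
  have hworst : ∀ (T : ℕ) (A : OnlineLearner X (List (𝓑 × Bool))),
      ENNReal.ofReal (T / 2) ≤ A.worstRegret μ 1 (Set.range (suffixLabel C)) T := by
    intro T A
    -- The adversary simply plays `μ` in every round.
    have hμ : (⟨μ, inferInstance⟩ : ProbabilityMeasure X) ∈ smoothDistributions μ 1 := by
      intro F _
      simp
    refine le_trans ?_ (le_iSup _ fun _ : Fin T => ⟨_, hμ⟩)
    calc ENNReal.ofReal (T / 2)
        = ∫⁻ _x : Fin T → X, ENNReal.ofReal (T / 2) ∂(Measure.pi fun _ : Fin T => μ) := by simp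
      _ ≤ _ := lintegral_mono_ae ((ae_injective_pi μ T).mono fun x hx => hregret T A x hx)
  intro hlearn
  have hev := hlearn.eventually_lt_const (show (0 : ℝ≥0∞) < 1 / 2 by simp)
  obtain ⟨T, hT, hT1⟩ := (hev.and (eventually_ge_atTop 1)).exists
  refine absurd hT (not_lt.2 ?_)
  have hT0 : (T : ℝ≥0∞) ≠ 0 := by
    simp only [ne_eq, Nat.cast_eq_zero]; omega
  rw [ENNReal.le_div_iff_mul_le (Or.inl hT0) (Or.inl (ENNReal.natCast_ne_top T))]
  refine le_trans (le_of_eq ?_) (le_iInf fun A => hworst T A)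
  rw [div_eq_inv_mul (T : ℝ), ENNReal.ofReal_mul (by norm_num), ENNReal.ofReal_natCast,
    ENNReal.ofReal_inv_of_pos (by norm_num)]
  simp

end Online

end SmoothedLearning

theorem corollary3p3 :
    ∃ (Y : Type) (_ : MeasurableSpace Y) (_ : StandardBorelSpace Y) (H : Set (unitInterval → Y)),
      H.Nonempty ∧ (∀ h ∈ H, Measurable h) ∧
      SmoothedLearning.AgnosticPACLearnable H ∧
      ¬ SmoothedLearning.SmoothedOnlineLearnable (volume : Measure unitInterval) 1 H := by
  let 𝓑 := TopologicalSpace.countableBasis unitInterval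
  have h𝓑 : TopologicalSpace.IsTopologicalBasis 𝓑 :=
    TopologicalSpace.isBasis_countableBasis unitInterval
  have : Countable 𝓑 := (TopologicalSpace.countable_countableBasis unitInterval).to_subtype
  let C : 𝓑 × Bool → Set unitInterval := fun e => (e.1 : Set unitInterval)
  have hC : ∀ e, MeasurableSet (C e) := fun e => (h𝓑.isOpen e.1.2).measurableSet
  let _ : MeasurableSpace (List (𝓑 × Bool)) := ⊤
  have : DiscreteMeasurableSpace (List (𝓑 × Bool)) := ⟨fun _ => trivial⟩
  refine ⟨List (𝓑 × Bool), inferInstance, inferInstance,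
    Set.range (SmoothedLearning.suffixLabel C), Set.range_nonempty _, ?_, ?_, ?_⟩
  · rintro _ ⟨L, rfl⟩
    exact SmoothedLearning.measurable_suffixLabel hC L
  · refine SmoothedLearning.agnosticPACLearnable_of_label_reconstruction (Set.range_nonempty _)
      (SmoothedLearning.suffixLabel C) (SmoothedLearning.measurable_suffixLabel hC) ?_
    rintro D _ ⟨L, rfl⟩ ε hε
    exact SmoothedLearning.exists_label_reconstruction hC D L hε
  · exact SmoothedLearning.not_smoothedOnlineLearnable_suffixLabel h𝓑 volume
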